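/- Theorem 1.2. For $f:\{0,1\}^n\to\{0,1\}$ let $\mathbb E f$ be the expectation of $f$ under the uniform measure on $\{0,1\}^n$. For $S\subseteq[n]$ let $$J_S^+(f)=\mu_{[n]\setminus S}\bigl(\{u\in\{0,1\}^{[n]\setminus S}:\exists v\in\{0,1\}^S,\ f(u,v)=1\}\bigr)=I_S^+(f)+\mathbb E f,$$ where $\mu_{[n]\setminus S}$ is the uniform probability measure on $\{0,1\}^{[n]\setminus S}$ and $I_S^+(f)$ is the influence of $S$ toward 1. Thus $J_S^+(f)$ is the probability that a uniformly random setting of the variables outside $S$ does not force $f=0$. (a) For all $\varepsilon\in(0,1)$ and $\delta>0$ there is $\alpha>0$ such that for every sufficiently large $n$ there is a Boolean function $f$ on $\{0,1\}^n$ with $\mathbb E f>(1-\varepsilon)^n$ and $J_S^+(f)\le\exp[-n^{\alpha}]$ for every $S\subseteq[n]$ with $|S|\le(1/2-\delta)n$. (b) For every $\delta>0$ there are $c,\alpha>0$ such that for every sufficiently large $n$ there is a Boolean function $f$ on $\{0,1\}^n$ with $\mathbb E f>\exp[-n^{1-c}]$ and $J_S^+(f)\le\exp[-n^{\alpha}]$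 for every $S\subseteq[n]$ with $|S|\le(1/2-\delta)n$. (c) Consequently the following conjecture is false: for some $\varepsilon\in(0,1)$, every Boolean function $f$ on $\{0,1\}^n$ with $\mathbb E f>(1-\varepsilon)^n$ admits a set $S\subseteq[n]$ with $|S|\le 0.1n$ and $J_S^+(f)\ge 1-o(1)$, where $o(1)\to0$ as $n\to\infty$, uniformly in $f$. -/

import Mathlib

namespace InfluentialCoalitions

/-- The uniform probability measure `μ_ι(A)` of a subset `A` of the discrete cube `{0,1}^ι`. -/
noncomputable def cubeProb {ι : Type*} [Fintype ι] (A : Set (ι → Bool)) : ℝ :=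
  (A.ncard : ℝ) / 2 ^ Fintype.card ι

/-- The expectation `E f = μ {x : f x = 1}` of a Boolean function on `{0,1}^n`. -/
noncomputable def expect {n : ℕ} (f : (Fin n → Bool) → Bool) : ℝ :=
  cubeProb {x | f x = true}

/-- The point `(u, v)` of `{0,1}^n` with coordinates `u` outside `S` and `v` on `S`. -/
def glue {n : ℕ} (S : Finset (Fin n)) (u : {i // i ∉ S} → Bool) (v : {i // i ∈ S} → Bool) :
    Fin n → Bool :=
  fun i => if h : i ∈ S then v ⟨i, h⟩ else u ⟨i, h⟩

/-- The influence of `S` toward one,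
`I_S^+(f) = μ_{[n] \ S} {u : ∃ v ∈ {0,1}^S, f(u, v) = 1} - E f`. -/
noncomputable def influenceTowardOne {n : ℕ} (S : Finset (Fin n)) (f : (Fin n → Bool) → Bool) :
    ℝ :=
  cubeProb {u : {i // i ∉ S} → Bool | ∃ v : {i // i ∈ S} → Bool, f (glue S u v) = true} - expect f

/-- The unsubtracted influence toward one, `J_S^+(f) = I_S^+(f) + E f`: the probability that a
uniform setting of the variables outside `S` does not force `f = 0`. -/
noncomputable def J {n : ℕ} (S : Finset (Fin n)) (f : (Fin n → Bool) → Bool) : ℝ :=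
  influenceTowardOne S f + expect f

/-- The conjecture that, for some `ε ∈ (0,1)`, every Boolean function `f` on `{0,1}^n` with
`E f > (1 - ε)^n` has a set `S` of at most `0.1 n` variables with `J_S^+(f) ≥ 1 - o(1)`
(where `o(1)` is as `n → ∞`, uniformly in `f`). -/
def SmallCoalitionConjecture : Prop :=
  ∃ ε : ℝ, 0 < ε ∧ ε < 1 ∧
    ∀ η : ℝ, 0 < η → ∀ᶠ n : ℕ in Filter.atTop, ∀ f : (Fin n → Bool) → Bool,
      (1 - ε) ^ n < expect f →
        ∃ S : Finset (Fin n), (S.card : ℝ) ≤ (1 / 10 : ℝ) * n ∧ 1 - η ≤ J S f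

end InfluentialCoalitions

/-!
Split the `n` variables into disjoint blocks of size of order `log n`, and let `f = 1` unless in
some block the zeros outnumber the ones by a fraction `δ` of the size of the block (`blockFun`).
Blocks are independent (`cubeProb_forall_fiber`), so both quantities in question are products.

* By Chernoff's bound a block of size at least `k` is violated with probability at most
  `p = exp (-δ² k / 2)`, which is a negative power of `n` when `k` is of order `log n`. Hence
  `E f ≥ (1 - p) ^ (number of blocks) ≥ exp (-2 p n) > exp (-n ^ (1 - c))`.
* If `S` occupies at most the fraction `(1 - δ) / 2` of a block and the variables of the block
  outside `S` all vanish, then the zeros have the majority `δ` in this block whatever `S` does, and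
  `f = 0` is forced. For blocks of size at most `2 k` this has probability at least `4 ^ (-k)`,
  which is at least `n ^ (-1 / 2)` when `16 ^ k ≤ n`. A set `S` of density at most `1 / 2 - δ` is that
  sparse in at least `δ n / (2 k)` blocks (`le_card_sparse_blocks`), so that
  `J S f ≤ (1 - n ^ (-1 / 2)) ^ (δ n / (2 k)) ≤ exp (-n ^ (1 / 4))` for large `n`.

The choice `k = ⌊log₁₆ n⌋` serves both estimates. As `exp (-n ^ (1 - c))` eventually exceeds
`(1 - ε) ^ n`, the other two assertions follow.
-/

open Finset

namespace InfluentialCoalitions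

/-! ### Probability on the discrete cube -/

section Cube

variable {ι κ : Type*} [Fintype ι] [Fintype κ]

theorem cubeProb_nonneg (A : Set (ι → Bool)) : 0 ≤ cubeProb A := by
  unfold cubeProb; positivity

theorem cubeProb_mono {A B : Set (ι → Bool)} (h : A ⊆ B) : cubeProb A ≤ cubeProb B := by
  unfold cubeProb
  gcongr
  exact Set.toFinite B

theorem cubeProb_add_compl (A : Set (ι → Bool)) : cubeProb A + cubeProb Aᶜ = 1 := by
  classical
  unfold cubeProb
  rw [← add_div, div_eq_one_iff_eq (by positivity)]
  have h := Set.ncard_add_ncard_compl A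
  rw [Nat.card_eq_fintype_card, Fintype.card_fun, Fintype.card_bool] at h
  exact_mod_cast h

theorem cubeProb_le_one (A : Set (ι → Bool)) : cubeProb A ≤ 1 := by
  linarith [cubeProb_add_compl A, cubeProb_nonneg Aᶜ]

/-- Events that depend on disjoint sets of coordinates, the fibres of `β`, are independent. -/
theorem cubeProb_forall_fiber [DecidableEq κ] (β : ι → κ)
    (A : ∀ b, Set ({i // β i = b} → Bool)) :
    cubeProb {x : ι → Bool | ∀ b, (fun i : {i // β i = b} => x i) ∈ A b} =
      ∏ b, cubeProb (A b) := by
  let e : (ι → Bool) ≃ ∀ b, {i // β i = b} → Bool :=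
    { toFun := fun x b i => x i
      invFun := fun y i => y (β i) ⟨i, rfl⟩
      left_inv := fun x => rfl
      right_inv := by
        intro y
        funext b ⟨i, hi⟩
        subst hi
        rfl }
  have hcard : {x : ι → Bool | ∀ b, (fun i : {i // β i = b} => x i) ∈ A b}.ncard =
      ∏ b, (A b).ncard := by
    simp only [← Nat.card_coe_set_eq]
    rw [← Nat.card_pi]
    exact Nat.card_congr
      ((e.subtypeEquiv fun x => Iff.rfl).trans
        (Equiv.subtypePiEquivPi (p := fun {b} y => y ∈ A b)))
  have hpow : (2 : ℝ) ^ Fintype.card ι = ∏ b, (2 : ℝ) ^ Fintype.card {i // β i = b} := by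
    rw [Finset.prod_pow_eq_pow_sum, ← Fintype.card_sigma,
      Fintype.card_congr (Equiv.sigmaFiberEquiv β)]
  simp only [cubeProb]
  rw [hcard, hpow, Finset.prod_div_distrib, Nat.cast_prod]

theorem cubeProb_exists_true :
    cubeProb {w : ι → Bool | ∃ i, w i = true} = 1 - (1 / 2) ^ Fintype.card ι := by
  have h := cubeProb_add_compl {w : ι → Bool | ∃ i, w i = true}
  have hc : {w : ι → Bool | ∃ i, w i = true}ᶜ = {fun _ => false} := by
    ext w
    simp [funext_iff]
  rw [hc] at h
  have h1 : cubeProb {(fun _ => false : ι → Bool)} = (1 / 2) ^ Fintype.card ι := by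
    simp [cubeProb]
  linarith

/-- The sign attached to a bit: `-1` for one and `1` for zero. -/
def bitSign (t : Bool) : ℝ := if t then -1 else 1

/-- **Chernoff's bound** for a sum of independent uniform signs. -/
theorem cubeProb_le_sum_bitSign_le (δ : ℝ) (hδ : 0 ≤ δ) :
    cubeProb {w : ι → Bool | δ * Fintype.card ι ≤ ∑ i, bitSign (w i)} ≤
      Real.exp (-(δ ^ 2 / 2) * Fintype.card ι) := by
  classical
  set N := Fintype.card ι
  set A := {w : ι → Bool | δ * N ≤ ∑ i, bitSign (w i)}
  have hsum : ∑ w : ι → Bool, Real.exp (δ * ∑ i, bitSign (w i)) = (2 * Real.cosh δ) ^ N := by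
    have h1 : ∀ w : ι → Bool, Real.exp (δ * ∑ i, bitSign (w i)) =
        ∏ i, Real.exp (δ * bitSign (w i)) := fun w => by
      rw [Finset.mul_sum, Real.exp_sum]
    simp_rw [h1]
    rw [← Fintype.prod_sum (fun (_ : ι) (t : Bool) => Real.exp (δ * bitSign t))]
    simp [bitSign, Real.cosh_eq, N]
    ring
  -- Markov's inequality for `exp (δ * ∑ i, bitSign (w i))`.
  have hmarkov : (A.ncard : ℝ) * Real.exp (δ * (δ * N)) ≤ (2 * Real.cosh δ) ^ N := by
    rw [← hsum, Set.ncard_eq_toFinset_card', ← nsmul_eq_mul]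
    refine (Finset.card_nsmul_le_sum _ _ _ fun w hw => ?_).trans
      (Finset.sum_le_sum_of_subset_of_nonneg (Finset.subset_univ A.toFinset)
        fun w _ _ => (Real.exp_pos _).le)
    rw [Set.mem_toFinset] at hw
    exact Real.exp_le_exp.2 (mul_le_mul_of_nonneg_left hw hδ)
  have hcosh : Real.cosh δ ^ N ≤ Real.exp (δ ^ 2 / 2 * N) := by
    rw [mul_comm, Real.exp_nat_mul]
    exact pow_le_pow_left₀ (Real.cosh_pos δ).le (Real.cosh_le_exp_half_sq δ) N
  have hexp : Real.exp (-(δ ^ 2 / 2) * N) * Real.exp (δ * (δ * N)) =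
      Real.exp (δ ^ 2 / 2 * N) := by
    rw [← Real.exp_add]; ring_nf
  rw [mul_pow] at hmarkov
  unfold cubeProb
  rw [div_le_iff₀ (by positivity)]
  refine le_of_mul_le_mul_right ?_ (Real.exp_pos (δ * (δ * N)))
  calc (A.ncard : ℝ) * Real.exp (δ * (δ * N)) ≤ 2 ^ N * Real.cosh δ ^ N := hmarkov
    _ ≤ 2 ^ N * Real.exp (δ ^ 2 / 2 * N) := by gcongr
    _ = _ := by rw [← hexp]; ring

end Cube

/-! ### Functions defined by blocks -/

section Blocks

variable {n : ℕ} {κ : Type*} [Fintype κ] [DecidableEq κ]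

/-- The Boolean function that is one when in no block, a fibre of `β`, does the number of
zeros exceed the number of ones by at least `δ` times the size of the block. -/
noncomputable def blockFun (β : Fin n → κ) (δ : ℝ) (x : Fin n → Bool) : Bool :=
  open Classical in
  decide (∀ b, (fun i : {i // β i = b} => x i) ∈
    {w : {i // β i = b} → Bool | δ * Fintype.card {i // β i = b} ≤ ∑ i, bitSign (w i)}ᶜ)

theorem pow_le_expect_blockFun (β : Fin n → κ) {δ : ℝ} (hδ : 0 ≤ δ) {k : ℕ}
    (hk : ∀ b, k ≤ Fintype.card {i // β i = b}) :
    (1 - Real.exp (-(δ ^ 2 / 2) * k)) ^ Fintype.card κ ≤ expect (blockFun β δ) := by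
  have h : expect (blockFun β δ) = ∏ b, cubeProb
      {w : {i // β i = b} → Bool | δ * Fintype.card {i // β i = b} ≤ ∑ i, bitSign (w i)}ᶜ := by
    rw [← cubeProb_forall_fiber]
    simp only [expect, blockFun, decide_eq_true_eq]
  rw [h, ← Finset.card_univ, ← Finset.prod_const]
  refine Finset.prod_le_prod (fun b _ => ?_) fun b _ => ?_
  · rw [sub_nonneg, Real.exp_le_one_iff]
    nlinarith [mul_nonneg (sq_nonneg δ) (Nat.cast_nonneg (α := ℝ) k)]
  · have h1 := cubeProb_add_compl
      {w : {i // β i = b} → Bool | δ * Fintype.card {i // β i = b} ≤ ∑ i, bitSign (w i)}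
    have h2 := cubeProb_le_sum_bitSign_le (ι := {i // β i = b}) δ hδ
    have h3 : Real.exp (-(δ ^ 2 / 2) * Fintype.card {i // β i = b}) ≤
        Real.exp (-(δ ^ 2 / 2) * k) := by
      refine Real.exp_le_exp.2 (mul_le_mul_of_nonpos_left ?_ (by nlinarith [sq_nonneg δ]))
      exact_mod_cast hk b
    linarith

/-- A block in which `S` occupies at most the fraction `(1 - δ) / 2` is falsified as soon as all
its coordinates outside `S` vanish. -/
theorem exists_true_of_blockFun_glue (β : Fin n → κ) {δ : ℝ} {S : Finset (Fin n)} {b : κ}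
    (hb : (#{i ∈ S | β i = b} : ℝ) ≤ (1 - δ) / 2 * Fintype.card {i // β i = b})
    {u : {i // i ∉ S} → Bool} {v : {i // i ∈ S} → Bool}
    (h : blockFun β δ (glue S u v) = true) :
    ∃ i : {i : {i // i ∉ S} // β i = b}, u i = true := by
  by_contra! hu
  simp only [blockFun, decide_eq_true_eq] at h
  refine h b ?_
  have hle : ∀ i : {i // β i = b}, 1 - 2 * (if i.1 ∈ S then 1 else 0 : ℝ) ≤
      bitSign (glue S u v i) := by
    rintro ⟨i, hi⟩
    by_cases hS : i ∈ S
    · simp only [hS, if_true, bitSign]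
      split_ifs <;> norm_num
    · have := hu ⟨⟨i, hS⟩, hi⟩
      simp only [Bool.not_eq_true] at this
      simp [hS, bitSign, glue, this]
  have hsum := Finset.sum_le_sum fun i (_ : i ∈ Finset.univ) => hle i
  have hcount : ∑ i : {i // β i = b}, (if i.1 ∈ S then 1 else 0 : ℝ) = #{i ∈ S | β i = b} := by
    rw [← Finset.sum_subtype {i | β i = b} (by simp) (fun i => if i ∈ S then (1 : ℝ) else 0)]
    rw [Finset.sum_ite_mem, Finset.sum_const, nsmul_one]
    congr 2
    ext i
    simp [and_comm]
  rw [Finset.sum_sub_distrib, ← Finset.mul_sum, hcount] at hsum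
  simp only [Finset.sum_const, Finset.card_univ, nsmul_one] at hsum
  rw [Set.mem_ofPred_eq]
  linarith

/-- The blocks in which `S` is sparse force `f = 0` independently, each with probability at least
`2 ^ (-K)`. -/
theorem J_blockFun_le (β : Fin n → κ) (δ : ℝ) {K : ℕ}
    (hK : ∀ b, Fintype.card {i // β i = b} ≤ K) (S : Finset (Fin n)) :
    J S (blockFun β δ) ≤ (1 - (1 / 2) ^ K) ^
      #{b | (#{i ∈ S | β i = b} : ℝ) ≤ (1 - δ) / 2 * Fintype.card {i // β i = b}} := by
  set G : Finset κ := {b | (#{i ∈ S | β i = b} : ℝ) ≤ (1 - δ) / 2 * Fintype.card {i // β i = b}}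
  let A : ∀ b, Set ({i : {i // i ∉ S} // β i = b} → Bool) :=
    fun b => {w | b ∈ G → ∃ i, w i = true}
  have hJ : J S (blockFun β δ) ≤ ∏ b, cubeProb (A b) := by
    rw [← cubeProb_forall_fiber (fun i : {i // i ∉ S} => β i), J, influenceTowardOne,
      sub_add_cancel]
    refine cubeProb_mono ?_
    rintro u ⟨v, hv⟩ b hb
    exact exists_true_of_blockFun_glue β (Finset.mem_filter.1 hb).2 hv
  refine hJ.trans ?_
  have hprod : ∏ b, (if b ∈ G then 1 - (1 / 2 : ℝ) ^ K else 1) = (1 - (1 / 2) ^ K) ^ #G := by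
    rw [Finset.prod_ite_mem, Finset.univ_inter, Finset.prod_const]
  rw [← hprod]
  refine Finset.prod_le_prod (fun b _ => cubeProb_nonneg _) fun b _ => ?_
  split_ifs with hb
  · have hA : A b = {w | ∃ i, w i = true} := by simp [A, hb]
    rw [hA, cubeProb_exists_true]
    refine sub_le_sub_left (pow_le_pow_of_le_one (by norm_num) (by norm_num) ?_) 1
    refine le_trans ?_ (hK b)
    exact Fintype.card_le_of_injective (fun i => (⟨i.1.1, i.2⟩ : {i // β i = b}))
      fun i j hij => by simpa [Subtype.ext_iff] using hij
  · exact cubeProb_le_one _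

/-- A set of density at most `1 / 2 - δ` has density at most `(1 - δ) / 2` in many blocks. -/
theorem le_card_sparse_blocks (β : Fin n → κ) {δ : ℝ} (hδ : 0 ≤ δ) {K : ℕ}
    (hK : ∀ b, Fintype.card {i // β i = b} ≤ K) {S : Finset (Fin n)}
    (hS : (#S : ℝ) ≤ (1 / 2 - δ) * n) :
    δ * n ≤ K *
      #{b | (#{i ∈ S | β i = b} : ℝ) ≤ (1 - δ) / 2 * Fintype.card {i // β i = b}} := by
  have h1 : (#S : ℝ) = ∑ b, (#{i ∈ S | β i = b} : ℝ) := by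
    exact_mod_cast Finset.card_eq_sum_card_fiberwise (fun i _ => Finset.mem_univ (β i))
  have h2 : (n : ℝ) = ∑ b, (Fintype.card {i // β i = b} : ℝ) := by
    have := Fintype.card_congr (Equiv.sigmaFiberEquiv β)
    rw [Fintype.card_sigma, Fintype.card_fin] at this
    exact_mod_cast this.symm
  -- Averaging: the excess of `(1 - δ) / 2` over the density of `S` is positive only in sparse
  -- blocks, and sums up to at least `δ * n / 2`.
  have h3 : ∀ b, (1 - δ) / 2 * (Fintype.card {i // β i = b} : ℝ) - #{i ∈ S | β i = b} ≤
      if (#{i ∈ S | β i = b} : ℝ) ≤ (1 - δ) / 2 * Fintype.card {i // β i = b}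
        then (K : ℝ) / 2 else 0 := by
    intro b
    have hb : (Fintype.card {i // β i = b} : ℝ) ≤ K := by exact_mod_cast hK b
    split_ifs with h
    · nlinarith [mul_nonneg hδ (Nat.cast_nonneg (α := ℝ) (Fintype.card {i // β i = b})),
        Nat.cast_nonneg (α := ℝ) #{i ∈ S | β i = b}]
    · linarith
  have h4 := Finset.sum_le_sum fun b (_ : b ∈ Finset.univ) => h3 b
  rw [Finset.sum_sub_distrib, ← Finset.mul_sum, ← h1, ← h2, ← Finset.sum_filter,
    Finset.sum_const, nsmul_eq_mul] at h4
  linarith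

end Blocks

/-! ### Choice of the blocks and asymptotics -/

/-- The residue classes modulo `n / k` split `{0, …, n - 1}` into blocks of sizes between `k` and
`2 * k`. -/
theorem exists_blocks {n k : ℕ} (hk : 2 ≤ k) (hn : 2 * k ≤ n) :
    ∃ β : Fin n → Fin (n / k), ∀ b,
      k ≤ Fintype.card {i // β i = b} ∧ Fintype.card {i // β i = b} ≤ 2 * k := by
  have hm : 2 ≤ n / k := (Nat.le_div_iff_mul_le (by omega)).2 hn
  set m := n / k with hmdef
  have hmk : m * k ≤ n := Nat.div_mul_le_self n k
  have hlt : n < (m + 1) * k := by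
    rw [mul_comm]; exact Nat.lt_mul_div_succ n (by omega)
  refine ⟨fun i => ⟨i % m, Nat.mod_lt _ (by omega)⟩, fun b => ?_⟩
  have hcard : Fintype.card {i : Fin n // (⟨i % m, Nat.mod_lt _ (by omega)⟩ : Fin m) = b} =
      n.count (· ≡ b [MOD m]) := by
    let _ := Nat.CountSet.fintype (· ≡ (b : ℕ) [MOD m]) n
    rw [Nat.count_eq_card_fintype]
    exact Fintype.card_congr
      { toFun := fun i => ⟨i.1, i.1.2, by
          rw [Nat.ModEq, Nat.mod_eq_of_lt b.2]; exact congrArg Fin.val i.2⟩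
        invFun := fun j => ⟨⟨j.1, j.2.1⟩, by
          have h := j.2.2
          rw [Nat.ModEq, Nat.mod_eq_of_lt b.2] at h
          exact Fin.ext h⟩
        left_inv := fun _ => rfl
        right_inv := fun _ => rfl }
  rw [hcard, Nat.count_modEq_card _ (by omega)]
  have h1 : k ≤ n / m := (Nat.le_div_iff_mul_le (by omega)).2 (by rwa [mul_comm])
  have h2 : n / m < 2 * k - 1 := by
    rw [Nat.div_lt_iff_lt_mul (by omega)]
    obtain ⟨a, rfl⟩ : ∃ a, k = a + 2 := ⟨k - 2, by omega⟩
    obtain ⟨c, hc⟩ : ∃ c, m = c + 2 := ⟨m - 2, by omega⟩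
    rw [hc] at hlt ⊢
    have : 2 * (a + 2) - 1 = 2 * a + 3 := by omega
    rw [this]
    nlinarith
  split_ifs <;> omega

/-- With `k = ⌊log₁₆ n⌋` and `q = n ^ c`, the probability `p` that a block is violated satisfies
`p * q ^ 2 ≤ exp (δ ^ 2 / 2)`: one factor `q` absorbs the constants, the other one is the gain. -/
theorem exp_neg_rpow_lt_expect_blockFun {n m : ℕ} {δ c : ℝ} (hδ : 0 < δ) (hm : m ≤ n) (hn : 0 < n)
    (hc : c = δ ^ 2 / (4 * Real.log 16))
    (hlarge : 2 * Real.exp (δ ^ 2 / 2) < (n : ℝ) ^ c) (β : Fin n → Fin m)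
    (hβ : ∀ b, Nat.log 16 n ≤ Fintype.card {i // β i = b}) :
    Real.exp (-(n : ℝ) ^ (1 - c)) < expect (blockFun β δ) := by
  have hn' : (0 : ℝ) < n := by exact_mod_cast hn
  have hL : 0 < Real.log 16 := Real.log_pos (by norm_num)
  have hc0 : 0 < c := by rw [hc]; positivity
  set k := Nat.log 16 n
  have hlog : Real.log n ≤ (k + 1) * Real.log 16 := by
    have h : (n : ℝ) ≤ 16 ^ (k + 1) := by
      exact_mod_cast (Nat.lt_pow_succ_log_self (by norm_num : 1 < 16) n).le
    simpa using Real.log_le_log hn' h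
  set p := Real.exp (-(δ ^ 2 / 2) * k)
  set q := (n : ℝ) ^ c
  have hq : 0 < q := Real.rpow_pos_of_pos hn' c
  have hp : p * q ^ 2 ≤ Real.exp (δ ^ 2 / 2) := by
    have hq2 : q ^ 2 = Real.exp (2 * c * Real.log n) := by
      rw [← Real.rpow_natCast, ← Real.rpow_mul hn'.le, Real.rpow_def_of_pos hn']
      congr 1; push_cast; ring
    rw [hq2, ← Real.exp_add, Real.exp_le_exp]
    have h : 2 * c * Real.log n ≤ 2 * c * ((k + 1) * Real.log 16) := by gcongr
    have h' : 2 * c * ((k + 1) * Real.log 16) = δ ^ 2 / 2 * (k + 1) := by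
      rw [hc]; field_simp; norm_num
    linarith
  have hpq : 2 * (p * q) < 1 := by nlinarith
  have hq1 : 1 ≤ q := by
    have := Real.one_le_exp (show 0 ≤ δ ^ 2 / 2 by positivity)
    linarith
  have hp0 : 0 < p := Real.exp_pos _
  have hp2 : p ≤ 1 / 2 := by nlinarith
  have h1p : Real.exp (-(2 * p)) ≤ 1 - p := by
    rw [Real.exp_neg, inv_le_comm₀ (Real.exp_pos _) (by linarith)]
    refine le_trans ?_ (Real.add_one_le_exp (2 * p))
    rw [inv_le_iff_one_le_mul₀ (by linarith)]
    nlinarith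
  refine lt_of_lt_of_le ?_ (pow_le_expect_blockFun β hδ.le hβ)
  refine lt_of_lt_of_le ?_ (pow_le_pow_left₀ (Real.exp_pos _).le h1p _)
  rw [← Real.exp_nat_mul, Real.exp_lt_exp, Fintype.card_fin, Real.rpow_sub hn', Real.rpow_one]
  have hm' : (m : ℝ) ≤ n := by exact_mod_cast hm
  have : 2 * p * m < n / q := by
    rw [lt_div_iff₀ hq]
    calc 2 * p * m * q = 2 * (p * q) * m := by ring
      _ ≤ 2 * (p * q) * n := by gcongr
      _ < 1 * n := by gcongr
      _ = n := one_mul _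
  linarith

/-- With `r = n ^ (1 / 4)` there are at least `r ^ 3` sparse blocks, and each forces the value zero
with probability at least `4 ^ (-k) ≥ r ^ (-2)`. -/
theorem J_blockFun_le_exp_neg_rpow {n : ℕ} {κ : Type*} [Fintype κ] [DecidableEq κ] {δ : ℝ}
    (hδ : 0 < δ) (hn : 0 < n) (hlarge : 2 * (Nat.log 16 n : ℝ) ≤ δ * (n : ℝ) ^ (1 / 4 : ℝ))
    (β : Fin n → κ) (hβ : ∀ b, Fintype.card {i // β i = b} ≤ 2 * Nat.log 16 n)
    {S : Finset (Fin n)} (hS : (#S : ℝ) ≤ (1 / 2 - δ) * n) :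
    J S (blockFun β δ) ≤ Real.exp (-(n : ℝ) ^ (1 / 4 : ℝ)) := by
  have hn' : (0 : ℝ) < n := by exact_mod_cast hn
  have hcount := le_card_sparse_blocks β hδ.le hβ hS
  refine (J_blockFun_le β δ hβ S).trans ?_
  set g := #{b | (#{i ∈ S | β i = b} : ℝ) ≤ (1 - δ) / 2 * Fintype.card {i // β i = b}}
  set k := Nat.log 16 n
  set r := (n : ℝ) ^ (1 / 4 : ℝ)
  have hr : 0 < r := Real.rpow_pos_of_pos hn' _
  have hr4 : (n : ℝ) = r ^ 4 := by
    rw [← Real.rpow_natCast, ← Real.rpow_mul hn'.le]; norm_num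
  have h4 : (4 : ℝ) ^ k ≤ r ^ 2 := by
    have h : (16 : ℝ) ^ k ≤ n := by exact_mod_cast Nat.pow_log_le_self 16 hn.ne'
    refine le_of_sq_le_sq ?_ (by positivity)
    calc ((4 : ℝ) ^ k) ^ 2 = 16 ^ k := by rw [pow_right_comm]; norm_num
      _ ≤ (r ^ 2) ^ 2 := by rw [← pow_mul, ← hr4]; exact h
  have hg : r ^ 3 ≤ g := by
    push_cast at hcount
    rw [hr4] at hcount
    refine le_of_mul_le_mul_left ?_ (mul_pos hδ hr)
    calc δ * r * r ^ 3 = δ * r ^ 4 := by ring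
      _ ≤ 2 * (k : ℝ) * g := hcount
      _ ≤ δ * r * g := mul_le_mul_of_nonneg_right hlarge (Nat.cast_nonneg g)
  have h1 : 1 - (1 / 2 : ℝ) ^ (2 * k) ≤ Real.exp (-(1 / 4 ^ k)) := by
    have h : (1 / 2 : ℝ) ^ (2 * k) = 1 / 4 ^ k := by
      rw [pow_mul, ← one_div_pow]; norm_num
    rw [h]
    exact Real.one_sub_le_exp_neg _
  refine (pow_le_pow_left₀ (sub_nonneg.2 (pow_le_one₀ (by norm_num) (by norm_num))) h1 _).trans ?_
  rw [← Real.exp_nat_mul, Real.exp_le_exp, mul_neg, neg_le_neg_iff, mul_one_div,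
    le_div_iff₀ (by positivity)]
  nlinarith

open Filter in
theorem exists_expect_gt_and_J_le {δ : ℝ} (hδ : 0 < δ) :
    ∃ c α : ℝ, 0 < c ∧ 0 < α ∧ ∀ᶠ n : ℕ in atTop, ∃ f : (Fin n → Bool) → Bool,
      Real.exp (-(n : ℝ) ^ (1 - c)) < expect f ∧
      ∀ S : Finset (Fin n), (#S : ℝ) ≤ (1 / 2 - δ) * n →
        J S f ≤ Real.exp (-(n : ℝ) ^ α) := by
  have hL : 0 < Real.log 16 := Real.log_pos (by norm_num)
  have hc : 0 < δ ^ 2 / (4 * Real.log 16) := by positivity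
  refine ⟨_, 1 / 4, hc, by norm_num, ?_⟩
  have hE := ((tendsto_rpow_atTop hc).comp tendsto_natCast_atTop_atTop).eventually_gt_atTop
    (2 * Real.exp (δ ^ 2 / 2))
  have hJ := tendsto_natCast_atTop_atTop.eventually
    ((isLittleO_log_rpow_atTop (show (0 : ℝ) < 1 / 4 by norm_num)).bound (half_pos hδ))
  filter_upwards [hE, hJ, eventually_ge_atTop (16 ^ 2)] with n hE hJ hn
  have hn0 : 0 < n := by omega
  have hn1 : (1 : ℝ) ≤ n := by exact_mod_cast hn0
  have hpow := Nat.pow_log_le_self 16 hn0.ne'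
  obtain ⟨β, hβ⟩ := exists_blocks (n := n) (k := Nat.log 16 n)
    ((Nat.le_log_iff_pow_le (by norm_num) hn0.ne').2 hn) (by
      refine le_trans (Nat.lt_pow_self (by norm_num : 1 < 4)).le ?_
      rw [pow_mul]
      exact hpow)
  have hk : (Nat.log 16 n : ℝ) ≤ Real.log n := by
    refine (Real.natLog_le_logb n 16).trans (div_le_self (Real.log_nonneg hn1) ?_)
    rw [Real.le_log_iff_exp_le (by norm_num)]
    exact (Real.exp_one_lt_d9.trans (by norm_num)).le
  have hJ' : 2 * (Nat.log 16 n : ℝ) ≤ δ * (n : ℝ) ^ (1 / 4 : ℝ) := by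
    rw [Real.norm_of_nonneg (Real.log_nonneg hn1), Real.norm_of_nonneg (by positivity)] at hJ
    linarith
  exact ⟨blockFun β δ,
    exp_neg_rpow_lt_expect_blockFun hδ (Nat.div_le_self _ _) hn0 rfl hE β fun b => (hβ b).1,
    fun S hS => J_blockFun_le_exp_neg_rpow hδ hn0 hJ' β (fun b => (hβ b).2) hS⟩

open Filter in
theorem exists_expect_gt_pow_and_J_le {ε δ : ℝ} (hε : 0 < ε) (hε1 : ε < 1) (hδ : 0 < δ) :
    ∃ α : ℝ, 0 < α ∧ ∀ᶠ n : ℕ in atTop, ∃ f : (Fin n → Bool) → Bool,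
      (1 - ε) ^ n < expect f ∧
      ∀ S : Finset (Fin n), (#S : ℝ) ≤ (1 / 2 - δ) * n →
        J S f ≤ Real.exp (-(n : ℝ) ^ α) := by
  obtain ⟨c, α, hc, hα, h⟩ := exists_expect_gt_and_J_le hδ
  refine ⟨α, hα, ?_⟩
  have hlarge := ((tendsto_rpow_atTop hc).comp tendsto_natCast_atTop_atTop).eventually_ge_atTop
    ε⁻¹
  filter_upwards [h, hlarge, eventually_gt_atTop 0] with n ⟨f, hf, hJ⟩ hlarge hn
  refine ⟨f, lt_of_le_of_lt ?_ hf, hJ⟩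
  have hn' : (0 : ℝ) < n := by exact_mod_cast hn
  refine (pow_le_pow_left₀ (by linarith) (Real.one_sub_le_exp_neg ε) n).trans ?_
  rw [← Real.exp_nat_mul, Real.exp_le_exp, mul_neg, neg_le_neg_iff, Real.rpow_sub hn',
    Real.rpow_one, div_eq_mul_inv]
  exact mul_le_mul_of_nonneg_left (inv_le_of_inv_le₀ hε hlarge) hn'.le

open Filter in
theorem not_smallCoalitionConjecture : ¬ SmallCoalitionConjecture := by
  rintro ⟨ε, hε, hε1, h⟩
  obtain ⟨α, hα, hex⟩ := exists_expect_gt_pow_and_J_le hε hε1 (show (0 : ℝ) < 2 / 5 by norm_num)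
  obtain ⟨n, hn, ⟨f, hf, hJ⟩, hn0⟩ :=
    ((h (1 / 4) (by norm_num)).and (hex.and (eventually_ge_atTop 1))).exists
  obtain ⟨S, hS, hS'⟩ := hn f hf
  have h1 := hJ S (by linarith)
  have h2 : Real.exp (-(n : ℝ) ^ α) ≤ Real.exp (-1) :=
    Real.exp_le_exp.2 (neg_le_neg (Real.one_le_rpow (by exact_mod_cast hn0) hα.le))
  linarith [Real.exp_neg_one_lt_d9]

end InfluentialCoalitions

theorem theorem1p2 :
    (∀ ε δ : ℝ, 0 < ε → ε < 1 → 0 < δ →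
      ∃ α : ℝ, 0 < α ∧ ∀ᶠ n : ℕ in Filter.atTop,
        ∃ f : (Fin n → Bool) → Bool,
          (1 - ε) ^ n < InfluentialCoalitions.expect f ∧
          ∀ S : Finset (Fin n), (S.card : ℝ) ≤ (1 / 2 - δ) * n →
            InfluentialCoalitions.J S f ≤ Real.exp (-(n : ℝ) ^ α)) ∧
    (∀ δ : ℝ, 0 < δ →
      ∃ c α : ℝ, 0 < c ∧ 0 < α ∧ ∀ᶠ n : ℕ in Filter.atTop,
        ∃ f : (Fin n → Bool) → Bool,
          Real.exp (-(n : ℝ) ^ (1 - c)) < InfluentialCoalitions.expect f ∧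
          ∀ S : Finset (Fin n), (S.card : ℝ) ≤ (1 / 2 - δ) * n →
            InfluentialCoalitions.J S f ≤ Real.exp (-(n : ℝ) ^ α)) ∧
    ¬ InfluentialCoalitions.SmallCoalitionConjecture :=
  ⟨fun _ _ hε hε1 hδ => InfluentialCoalitions.exists_expect_gt_pow_and_J_le hε hε1 hδ,
    fun _ hδ => InfluentialCoalitions.exists_expect_gt_and_J_le hδ,
    InfluentialCoalitions.not_smallCoalitionConjecture⟩
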